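/- Let $G$ be a simply connected, simple, compact (anisotropic) linear algebraic group over $\mathbb R$, let $T\subset G$ be a maximal torus, $\Pi=\{\alpha_1,\dots,\alpha_n\}$ a basis of the root system $R(G_{\mathbb C},T_{\mathbb C})$, and $\Pi^\vee=\{\alpha_1^\vee,\dots,\alpha_n^\vee\}$ the corresponding basis of the dual root system formed by the simple coroots. Let $N$ be the normalizer of $T$ in $G$ and $W$ the Weyl group, each element of which is represented by some $\nu\in N(\mathbb R)$. Let $r_i\in W$ be the reflection corresponding to $\alpha_i$. Write $T(\mathbb R)_2$ for the group of elements of $T(\mathbb R)$ of order dividing $2$, and put $T^{\mathrm{ad}}=T/Z_G$, where $Z_G$ is the center of $G$. Let $t\in T^{\mathrm{ad}}(\mathbb R)_2$, let $\tilde t\in T(\mathbb C)$ be a lift of $t$, and define $t_i\in\mathbb Z/2\mathbb Z$ by $(-1)^{t_i}=\alpha_i(t)$. The $t$-twisted action of $W$ on $T(\mathbb R)_2$ is given by $$w*a=\nu\,a\,\bigl(\tilde t\,\bar \nu\,\tilde t^{-1}\bigr)^{-1}=\nu a \nu^{-1}\cdot \nu\tilde t \nu^{-1}\tilde t^{-1}\qquad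 (w=\nu T,\ \nu\in N(\mathbb R)).$$ Then the map $$\gamma\colon(\mathbb Z/2\mathbb Z)^n\to T(\mathbb R)_2,\qquad (a_j)\mapsto\prod_{j=1}^n\alpha_j^\vee(-1)^{a_j},$$ is an isomorphism of groups. If $a,a'\in(\mathbb Z/2\mathbb Z)^n$ and $1\le i\le n$ are such that $r_i*\gamma(a)=\gamma(a')$, then $a'_j=a_j$ for all $j\ne i$, and $$a'_i=a_i+t_i+\sideset{}{'}\sum_{k} a_k ,$$ where the sum is taken over all neighbors $k\ne i$ of $i$ in the Dynkin diagram of $\Pi$, except for the vertices $k$ connected to $i$ by a double edge such that the root $\alpha_k$ is shorter than $\alpha_i$ (lengths being taken with respect to a $W$-invariant inner product on $\mathbb R\otimes \mathsf X^*(T_{\mathbb C})$). -/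

import Mathlib

open scoped TensorProduct

namespace RealAlg

noncomputable section

/-! Linear algebraic groups over `ℝ` are described by their groups of complex points: a linear
algebraic group over `ℝ` is a subgroup of `GL m ℂ` that is the zero locus of polynomials with real
coefficients in the matrix entries. -/

/-- Complex conjugation on `GL m ℂ`, entry by entry. -/
def conj {m : ℕ} : GL (Fin m) ℂ →* GL (Fin m) ℂ :=
  Matrix.GeneralLinearGroup.map (starRingEnd ℂ)

/-- `S` is a Zariski closed subset of `GL m ℂ` defined by equations with coefficients in `K`. -/
def IsZariskiClosed (K : Type) [Field K] [Algebra K ℂ] {m : ℕ} (S : Set (GL (Fin m) ℂ)) : Prop :=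
  ∃ I : Set (MvPolynomial (Fin m × Fin m) K),
    S = {g | ∀ p ∈ I, MvPolynomial.aeval (fun ij : Fin m × Fin m => g.val ij.1 ij.2) p = 0}

/-- `S` is connected in the Zariski topology of `GL m ℂ` (the empty set is allowed). -/
def IsZariskiConnected {m : ℕ} (S : Set (GL (Fin m) ℂ)) : Prop :=
  ∀ A B : Set (GL (Fin m) ℂ), IsZariskiClosed ℂ A → IsZariskiClosed ℂ B →
    S ⊆ A ∪ B → S ∩ (A ∩ B) = ∅ → S ⊆ A ∨ S ⊆ B

/-- A linear algebraic group over `ℝ`, given by its group of complex points. -/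
structure RealGroup (m : ℕ) where
  pts : Subgroup (GL (Fin m) ℂ)
  isClosed : IsZariskiClosed ℝ (pts : Set (GL (Fin m) ℂ))

/-- `G` is simple: it is connected, not commutative, and its only connected normal algebraic
subgroups over `ℝ` are `1` and `G`. -/
def RealGroup.IsSimple {m : ℕ} (G : RealGroup m) : Prop :=
  IsZariskiConnected (G.pts : Set (GL (Fin m) ℂ)) ∧
  (∃ g ∈ G.pts, ∃ h ∈ G.pts, g * h ≠ h * g) ∧
  ∀ N : Subgroup (GL (Fin m) ℂ), N ≤ G.pts → IsZariskiClosed ℝ (N : Set (GL (Fin m) ℂ)) →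
    IsZariskiConnected (N : Set (GL (Fin m) ℂ)) →
    (∀ g ∈ G.pts, ∀ x ∈ N, g * x * g⁻¹ ∈ N) → N = ⊥ ∨ N = G.pts

/-- `G` is compact (anisotropic): its group of real points is compact in the usual topology. -/
def RealGroup.IsCompactGroup {m : ℕ} (G : RealGroup m) : Prop :=
  IsCompact {g : GL (Fin m) ℂ | g ∈ G.pts ∧ conj g = g}

/-- The Lie algebra of `G` over `ℂ`, as the tangent space at `1`: the matrices `X` along which the
derivative at `1` of every polynomial vanishing on `G` is zero. -/
def RealGroup.lie {m : ℕ} (G : RealGroup m) : Set (Matrix (Fin m) (Fin m) ℂ) :=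
  {X | ∀ p : MvPolynomial (Fin m × Fin m) ℂ,
    (∀ g ∈ G.pts, MvPolynomial.eval (fun ij => g.val ij.1 ij.2) p = 0) →
    ∑ ij : Fin m × Fin m, X ij.1 ij.2 *
      MvPolynomial.eval (fun kl => (1 : Matrix (Fin m) (Fin m) ℂ) kl.1 kl.2)
        (MvPolynomial.pderiv ij p) = 0}

/-- The coordinates on `GL m`: the entries of `g` and of `g⁻¹`. Polynomials in them are the regular
functions on `GL m`. -/
def coords {m : ℕ} (g : GL (Fin m) ℂ) : (Fin m × Fin m) ⊕ (Fin m × Fin m) → ℂ :=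
  Sum.elim (fun ij => g.val ij.1 ij.2) (fun ij => (g⁻¹).val ij.1 ij.2)

/-- The coordinates on the standard torus `(ℂˣ)^r`: the `zᵢ` and the `zᵢ⁻¹`. Polynomials in them are
the regular functions on that torus. -/
def unitCoords {r : ℕ} (z : Fin r → ℂˣ) : Fin r ⊕ Fin r → ℂ :=
  Sum.elim (fun i => (z i : ℂ)) (fun i => ((z i)⁻¹ : ℂˣ))

/-- `S` is a torus over `ℂ`: it is isomorphic to some `(ℂˣ)^r` as an algebraic group. -/
def IsTorus {m : ℕ} (S : Subgroup (GL (Fin m) ℂ)) : Prop :=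
  ∃ (r : ℕ) (e : (Fin r → ℂˣ) ≃* S),
    (∀ i j, ∃ p : MvPolynomial (Fin r ⊕ Fin r) ℂ,
      ∀ z, (e z : GL (Fin m) ℂ).val i j = MvPolynomial.eval (unitCoords z) p) ∧
    (∀ i, ∃ p : MvPolynomial ((Fin m × Fin m) ⊕ (Fin m × Fin m)) ℂ,
      ∀ s : S, ((e.symm s i : ℂˣ) : ℂ) = MvPolynomial.eval (coords (s : GL (Fin m) ℂ)) p)

/-- A maximal torus (defined over `ℝ`) of `G`. -/
structure MaxTorus {m : ℕ} (G : RealGroup m) where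
  pts : Subgroup (GL (Fin m) ℂ)
  isClosed : IsZariskiClosed ℝ (pts : Set (GL (Fin m) ℂ))
  isTorus : IsTorus pts
  le : pts ≤ G.pts
  maximal : ∀ S : Subgroup (GL (Fin m) ℂ), S ≤ G.pts →
    IsZariskiClosed ℝ (S : Set (GL (Fin m) ℂ)) → IsTorus S → pts ≤ S → S = pts

theorem conj_mem_of_isZariskiClosed {m : ℕ} {S : Set (GL (Fin m) ℂ)} (hS : IsZariskiClosed ℝ S)
    {g : GL (Fin m) ℂ} (hg : g ∈ S) : conj g ∈ S := by
  obtain ⟨I, rfl⟩ := hS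
  intro p hp
  have h := congrArg Complex.conjAe.toAlgHom (hg p hp)
  rw [map_zero] at h
  rw [← h, ← AlgHom.comp_apply, MvPolynomial.comp_aeval]
  rfl

theorem conj_conj {m : ℕ} (g : GL (Fin m) ℂ) : conj (conj g) = g := by
  ext i j
  simp [conj]

namespace MaxTorus

variable {m : ℕ} {G : RealGroup m} (T : MaxTorus G)

theorem comm (s t : GL (Fin m) ℂ) (hs : s ∈ T.pts) (ht : t ∈ T.pts) : s * t = t * s := by
  obtain ⟨r, e, -, -⟩ := T.isTorus
  have h : (⟨s, hs⟩ : T.pts) * ⟨t, ht⟩ = ⟨t, ht⟩ * ⟨s, hs⟩ := by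
    apply e.symm.injective
    rw [map_mul, map_mul, mul_comm]
  exact congrArg Subtype.val h

instance : CommGroup T.pts :=
  { (inferInstance : Group T.pts) with
    mul_comm := fun s t => Subtype.ext (T.comm s t s.2 t.2) }

/-- The character group `X^* = Hom(T, 𝔾ₘ)`: the homomorphisms `T → ℂˣ` that are regular functions. -/
def chars : Subgroup (T.pts →* ℂˣ) where
  carrier := {χ | ∃ p : MvPolynomial ((Fin m × Fin m) ⊕ (Fin m × Fin m)) ℂ,
    ∀ t : T.pts, (χ t : ℂ) = MvPolynomial.eval (coords (t : GL (Fin m) ℂ)) p}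
  one_mem' := ⟨1, by simp⟩
  mul_mem' := by
    rintro χ ψ ⟨p, hp⟩ ⟨q, hq⟩
    exact ⟨p * q, fun t => by simp [hp, hq]⟩
  inv_mem' := by
    rintro χ ⟨p, hp⟩
    refine ⟨MvPolynomial.rename Sum.swap p, fun t => ?_⟩
    have h : coords (t : GL (Fin m) ℂ) ∘ Sum.swap = coords ((t⁻¹ : T.pts) : GL (Fin m) ℂ) := by
      funext x
      rcases x with x | x <;> simp [coords]
    rw [MvPolynomial.eval_rename, h, ← hp, map_inv, MonoidHom.inv_apply]

/-- The cocharacter group `X_* = Hom(𝔾ₘ, T)`: the homomorphisms `ℂˣ → T` whose matrix entries are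
Laurent polynomials. -/
def cochars : Subgroup (ℂˣ →* T.pts) where
  carrier := {x | ∀ i j, ∃ p : MvPolynomial (Fin 1 ⊕ Fin 1) ℂ,
    ∀ z : ℂˣ, (x z : GL (Fin m) ℂ).val i j = MvPolynomial.eval (unitCoords fun _ => z) p}
  one_mem' := fun i j => ⟨MvPolynomial.C ((1 : Matrix (Fin m) (Fin m) ℂ) i j), by simp⟩
  mul_mem' := by
    intro x y hx hy i j
    choose p hp using hx
    choose q hq using hy
    refine ⟨∑ k, p i k * q k j, fun z => ?_⟩
    simp [Matrix.mul_apply, ← hp, ← hq]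
  inv_mem' := by
    intro x hx i j
    obtain ⟨p, hp⟩ := hx i j
    refine ⟨MvPolynomial.rename Sum.swap p, fun z => ?_⟩
    have h : (unitCoords (fun _ : Fin 1 => z)) ∘ Sum.swap = unitCoords (fun _ => z⁻¹) := by
      funext x
      rcases x with x | x <;> simp [unitCoords]
    rw [MvPolynomial.eval_rename, h, ← hp, map_inv, MonoidHom.inv_apply]

/-- The canonical pairing `⟨χ, x⟩ ∈ ℤ`, defined by `χ (x z) = z ^ ⟨χ, x⟩`. -/
def pairing (χ : T.chars) (x : T.cochars) : ℤ :=
  open Classical in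
  if h : ∃ k : ℤ, ∀ z : ℂˣ, χ.1 (x.1 z) = z ^ k then h.choose else 0

/-- The real points `N(ℝ)` of the normalizer `N` of `T` in `G`. -/
def normR : Subgroup (GL (Fin m) ℂ) where
  carrier := {n | n ∈ G.pts ∧ n ∈ Subgroup.normalizer (T.pts : Set (GL (Fin m) ℂ)) ∧ conj n = n}
  one_mem' := ⟨one_mem _, one_mem _, map_one _⟩
  mul_mem' := fun ⟨h1, h2, h3⟩ ⟨k1, k2, k3⟩ =>
    ⟨mul_mem h1 k1, mul_mem h2 k2, by rw [map_mul, h3, k3]⟩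
  inv_mem' := fun ⟨h1, h2, h3⟩ => ⟨inv_mem h1, inv_mem h2, by rw [map_inv, h3]⟩

/-- `T(ℝ)` as a subgroup of `N(ℝ)`. -/
def torusR : Subgroup T.normR := T.pts.subgroupOf T.normR

instance : T.torusR.Normal where
  conj_mem t ht n := (n.2.2.1 t.1).1 ht

/-- The Weyl group `W = N(ℝ)/T(ℝ)`. -/
abbrev Weyl : Type := T.normR ⧸ T.torusR

/-- `n ∈ N(ℝ)` acts on `T` by `t ↦ n t n⁻¹`. -/
def normAct : T.normR →* MulAut T.pts :=
  T.pts.normalizerMonoidHom.comp (Subgroup.inclusion fun _ h => h.2.1)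

theorem coe_normAct (n : T.normR) (t : T.pts) :
    (T.normAct n t : GL (Fin m) ℂ) = n.1 * t.1 * n.1⁻¹ := rfl

/-- The action of the Weyl group on `T`: the class of `n` acts by `t ↦ n t n⁻¹`. -/
def weylAct : T.Weyl →* MulAut T.pts :=
  QuotientGroup.lift T.torusR T.normAct (by
    intro n hn
    ext1 t
    apply Subtype.ext
    rw [coe_normAct, T.comm n.1 t.1 hn t.2, mul_inv_cancel_right]
    rfl)

/-- The action of the Weyl group on characters: `χ ↦ χ ∘ w⁻¹`. -/
def weylChar (w : T.Weyl) (χ : T.chars) : T.chars :=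
  ⟨χ.1.comp (T.weylAct w⁻¹).toMonoidHom, by
    obtain ⟨p, hp⟩ := χ.2
    obtain ⟨n, hn⟩ := QuotientGroup.mk_surjective w⁻¹
    rw [← hn]
    refine ⟨MvPolynomial.bind₁ (Sum.elim
      (fun ij => ∑ l, (∑ k, MvPolynomial.C (n.1.val ij.1 k) * MvPolynomial.X (Sum.inl (k, l))) *
        MvPolynomial.C ((n.1⁻¹).val l ij.2))
      (fun ij => ∑ l, (∑ k, MvPolynomial.C (n.1.val ij.1 k) * MvPolynomial.X (Sum.inr (k, l))) *
        MvPolynomial.C ((n.1⁻¹).val l ij.2))) p, fun t => ?_⟩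
    have h : ((T.weylAct (n : T.Weyl) t : T.pts) : GL (Fin m) ℂ) = n.1 * t.1 * n.1⁻¹ := rfl
    have h' : ((T.weylAct (n : T.Weyl) t : T.pts) : GL (Fin m) ℂ)⁻¹ = n.1 * t.1⁻¹ * n.1⁻¹ := by
      rw [h]; group
    change (χ.1 (T.weylAct (n : T.Weyl) t) : ℂ) = _
    rw [hp, ← MvPolynomial.coe_aeval_eq_eval, ← MvPolynomial.coe_aeval_eq_eval]
    simp only [RingHom.coe_coe]
    rw [MvPolynomial.aeval_bind₁]
    congr 2
    funext x
    rcases x with x | x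
    · simp only [coords, Sum.elim_inl, h]
      simp [Matrix.mul_apply]
    · simp only [coords, Sum.elim_inr, h']
      simp [Matrix.mul_apply]⟩

/-- `χ` is a root of `G` with respect to `T`: a nontrivial character that occurs in the adjoint
representation of `T` on the Lie algebra of `G`. -/
def IsRoot (χ : T.chars) : Prop :=
  χ ≠ 1 ∧ ∃ X ∈ G.lie, X ≠ 0 ∧
    ∀ t : T.pts, t.1.val * X * (t.1⁻¹).val = (χ.1 t : ℂ) • X

/-- `w ∈ W` acts on `X_*` as the reflection `y ↦ y - ⟨χ, y⟩ x` (written multiplicatively). -/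
def IsReflection (w : T.Weyl) (χ : T.chars) (x : T.cochars) : Prop :=
  ∀ y : T.cochars, (T.weylAct w).toMonoidHom.comp y.1 = y.1 / x.1 ^ T.pairing χ y

/-- `x` is the coroot `χ^∨` of the root `χ`: the cocharacter with `⟨χ, χ^∨⟩ = 2` such that
`y ↦ y - ⟨χ, y⟩ χ^∨` is given by an element of the Weyl group. -/
def IsCorootOf (χ : T.chars) (x : T.cochars) : Prop :=
  T.IsRoot χ ∧ T.pairing χ x = 2 ∧ ∃ w : T.Weyl, T.IsReflection w χ x

/-- `Π = {α₁, …, αₙ}` is a base of the root system of `(G, T)`, with coroots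
`Π^∨ = {α₁^∨, …, αₙ^∨}` forming the corresponding base of the dual root system: both are linearly
independent, and every root (every coroot) is a combination of simple roots (simple coroots) with
coefficients all `≥ 0` or all `≤ 0`. This is the convention of `RootPairing.Base`. -/
structure IsBase {n : ℕ} (α : Fin n → T.chars) (αv : Fin n → T.cochars) : Prop where
  coroot : ∀ i, T.IsCorootOf (α i) (αv i)
  linearIndependent_root : LinearIndependent ℤ fun i => Additive.ofMul (α i)
  linearIndependent_coroot : LinearIndependent ℤ fun i => Additive.ofMul (αv i)
  root_mem_or_inv_mem : ∀ β : T.chars, T.IsRoot β →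
    β ∈ Submonoid.closure (Set.range α) ∨ β⁻¹ ∈ Submonoid.closure (Set.range α)
  coroot_mem_or_inv_mem : ∀ (β : T.chars) (x : T.cochars), T.IsCorootOf β x →
    x ∈ Submonoid.closure (Set.range αv) ∨ x⁻¹ ∈ Submonoid.closure (Set.range αv)

/-- `G` is simply connected: the coroots generate the cocharacter group of the maximal torus. -/
def IsSimplyConnected : Prop :=
  Subgroup.closure {x : T.cochars | ∃ β, T.IsCorootOf β x} = ⊤

/-- A `W`-invariant inner product on the real vector space `ℝ ⊗ X^*`. -/
structure IsInvariantInner (B : LinearMap.BilinForm ℝ (ℝ ⊗[ℤ] Additive T.chars)) : Prop where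
  symm : ∀ u v, B u v = B v u
  pos : ∀ v, v ≠ 0 → 0 < B v v
  invariant : ∀ (w : T.Weyl) (χ ψ : T.chars),
    B (1 ⊗ₜ Additive.ofMul (T.weylChar w χ)) (1 ⊗ₜ Additive.ofMul (T.weylChar w ψ)) =
      B (1 ⊗ₜ Additive.ofMul χ) (1 ⊗ₜ Additive.ofMul ψ)

/-- The squared length of a character. -/
def sqLength (B : LinearMap.BilinForm ℝ (ℝ ⊗[ℤ] Additive T.chars)) (χ : T.chars) : ℝ :=
  B (1 ⊗ₜ Additive.ofMul χ) (1 ⊗ₜ Additive.ofMul χ)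

/-- The number of edges of the Dynkin diagram between the vertices `i` and `k`. -/
def edges {n : ℕ} (α : Fin n → T.chars) (αv : Fin n → T.cochars) (i k : Fin n) : ℤ :=
  if i = k then 0 else T.pairing (α i) (αv k) * T.pairing (α k) (αv i)

open Classical in
/-- The vertices `k` over which the sum for the vertex `i` is taken: the neighbours of `i`, except
those joined to `i` by a double edge such that `α k` is shorter than `α i`. -/
def summationSet {n : ℕ} (α : Fin n → T.chars) (αv : Fin n → T.cochars)
    (B : LinearMap.BilinForm ℝ (ℝ ⊗[ℤ] Additive T.chars)) (i : Fin n) : Finset (Fin n) :=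
  Finset.univ.filter fun k => T.edges α αv i k ≠ 0 ∧
    ¬ (T.edges α αv i k = 2 ∧ T.sqLength B (α k) < T.sqLength B (α i))

/-- `T(ℝ)₂`: the elements `a` of `T(ℝ)` with `a² = 1`. -/
def two : Subgroup T.pts where
  carrier := {a | conj a.1 = a.1 ∧ a ^ 2 = 1}
  one_mem' := ⟨map_one _, one_pow _⟩
  mul_mem' := fun {a b} ⟨h1, h2⟩ ⟨k1, k2⟩ =>
    ⟨by rw [Subgroup.coe_mul, map_mul, h1, k1], by rw [mul_pow, h2, k2, one_mul]⟩
  inv_mem' := fun {a} ⟨h1, h2⟩ =>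
    ⟨by rw [Subgroup.coe_inv, map_inv, h1], by rw [inv_pow, h2, inv_one]⟩

/-- The center of `G`, as a subgroup of `T`: the elements of `T` that commute with all of `G`. -/
def center : Subgroup T.pts :=
  (Subgroup.centralizer (G.pts : Set (GL (Fin m) ℂ))).subgroupOf T.pts

/-- Complex conjugation on `T`. -/
def conjT : T.pts →* T.pts :=
  (conj.comp T.pts.subtype).codRestrict T.pts
    fun t => conj_mem_of_isZariskiClosed T.isClosed t.2

theorem coe_conjT (t : T.pts) : (T.conjT t : GL (Fin m) ℂ) = conj t.1 := rfl

theorem conjT_mem_center {z : T.pts} (hz : z ∈ T.center) : T.conjT z ∈ T.center := by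
  intro g hg
  have h := hz (conj g) (conj_mem_of_isZariskiClosed G.isClosed hg)
  have h' := congrArg conj h
  rw [map_mul, map_mul, conj_conj] at h'
  exact h'

/-- `T^ad = T/Z_G`, a maximal torus of `G^ad = G/Z_G` (complex points). -/
abbrev Tad : Type := T.pts ⧸ T.center

/-- Complex conjugation on `T^ad`. -/
def conjTad : T.Tad →* T.Tad :=
  QuotientGroup.map T.center T.center T.conjT fun _ hz => T.conjT_mem_center hz

/-- `t ∈ T^ad(ℝ)₂`. -/
def IsAdTwo (t : T.Tad) : Prop := T.conjTad t = t ∧ t ^ 2 = 1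

/-- Complex conjugation `g ↦ t̃ ḡ t̃⁻¹` in the twisted form of `G` by the image of `t̃`. -/
def twistedConj (tl : T.pts) (g : GL (Fin m) ℂ) : GL (Fin m) ℂ := tl.1 * conj g * tl.1⁻¹

theorem twisted_eq (tl : T.pts) (n : T.normR) (a : T.pts) :
    n.1 * a.1 * (twistedConj T tl n.1)⁻¹ = (T.normAct n (a * tl) * tl⁻¹ : T.pts).1 := by
  simp only [twistedConj, n.2.2.2, Subgroup.coe_mul, coe_normAct, Subgroup.coe_inv]
  group

theorem normAct_center (n : T.normR) {z : T.pts} (hz : z ∈ T.center) : T.normAct n z = z := by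
  apply Subtype.ext
  have h : n.1 * z.1 = z.1 * n.1 := hz n.1 n.2.1
  rw [coe_normAct, h, mul_inv_cancel_right]

theorem conjT_normAct (n : T.normR) (t : T.pts) :
    T.conjT (T.normAct n t) = T.normAct n (T.conjT t) := by
  apply Subtype.ext
  simp only [coe_conjT, coe_normAct, map_mul, map_inv, n.2.2.2]

theorem twisted_mem_two {t : T.Tad} (ht : T.IsAdTwo t) {tl : T.pts} (htl : (tl : T.Tad) = t)
    (n : T.normR) (a : T.two) : T.normAct n (a.1 * tl) * tl⁻¹ ∈ T.two := by
  subst htl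
  obtain ⟨hr, h2⟩ := ht
  have hz2 : tl ^ 2 ∈ T.center := by
    rw [← QuotientGroup.eq_one_iff]
    exact h2
  have hzr : tl⁻¹ * T.conjT tl ∈ T.center := by
    rw [← QuotientGroup.eq]
    exact hr.symm
  constructor
  · have e : T.conjT tl = tl * (tl⁻¹ * T.conjT tl) := by group
    have ha : T.conjT a.1 = a.1 := Subtype.ext a.2.1
    have key : T.conjT (T.normAct n (a.1 * tl) * tl⁻¹) = T.normAct n (a.1 * tl) * tl⁻¹ := by
      have e' : T.normAct n (T.conjT tl) = T.normAct n tl * (tl⁻¹ * T.conjT tl) := by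
        conv_lhs => rw [e]
        rw [map_mul, T.normAct_center n hzr]
      rw [map_mul, map_inv, conjT_normAct, map_mul, ha, map_mul, e', map_mul, ← mul_assoc,
        ← mul_assoc, mul_inv_cancel_right]
    exact congrArg Subtype.val key
  · rw [mul_pow, ← map_pow, mul_pow, a.2.2, one_mul, T.normAct_center n hz2, inv_pow,
      mul_inv_cancel]

/-- The `t`-twisted action of the Weyl group on `T(ℝ)₂`: the class of `n ∈ N(ℝ)` sends `a` to
`n a (t̃ n̄ t̃⁻¹)⁻¹`, where `t̃ ∈ T(ℂ)` is any lift of `t`. -/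
def twistedAct {t : T.Tad} (ht : T.IsAdTwo t) {tl : T.pts} (htl : (tl : T.Tad) = t)
    (w : T.Weyl) (a : T.two) : T.two :=
  Quotient.liftOn' w
    (fun n => ⟨⟨n.1 * a.1.1 * (twistedConj T tl n.1)⁻¹, by
        rw [twisted_eq]; exact Subtype.prop _⟩, by
        simp only [twisted_eq]; exact T.twisted_mem_two ht htl n a⟩)
    (by
      intro n n' h
      have h' : T.weylAct (n : T.Weyl) = T.weylAct (n' : T.Weyl) := by
        rw [show (n : T.Weyl) = (n' : T.Weyl) from Quotient.sound' h]
      have h'' : T.normAct n = T.normAct n' := h'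
      apply Subtype.ext
      apply Subtype.ext
      change n.1 * a.1.1 * (twistedConj T tl n.1)⁻¹ = n'.1 * a.1.1 * (twistedConj T tl n'.1)⁻¹
      rw [twisted_eq, twisted_eq, h''])

theorem coe_twistedAct {t : T.Tad} (ht : T.IsAdTwo t) {tl : T.pts} (htl : (tl : T.Tad) = t)
    (n : T.normR) (a : T.two) :
    ((T.twistedAct ht htl (n : T.Weyl) a).1 : GL (Fin m) ℂ) =
      n.1 * a.1.1 * (twistedConj T tl n.1)⁻¹ := rfl

theorem twistedAct_one {t : T.Tad} (ht : T.IsAdTwo t) {tl : T.pts} (htl : (tl : T.Tad) = t)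
    (a : T.two) : T.twistedAct ht htl 1 a = a := by
  apply Subtype.ext
  apply Subtype.ext
  change (1 : GL (Fin m) ℂ) * a.1.1 * (twistedConj T tl 1)⁻¹ = a.1.1
  simp [twistedConj]

theorem twistedAct_mul {t : T.Tad} (ht : T.IsAdTwo t) {tl : T.pts} (htl : (tl : T.Tad) = t)
    (v w : T.Weyl) (a : T.two) :
    T.twistedAct ht htl (v * w) a = T.twistedAct ht htl v (T.twistedAct ht htl w a) := by
  obtain ⟨n, rfl⟩ := QuotientGroup.mk_surjective v
  obtain ⟨k, rfl⟩ := QuotientGroup.mk_surjective w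
  apply Subtype.ext
  apply Subtype.ext
  rw [← QuotientGroup.mk_mul, coe_twistedAct, coe_twistedAct, coe_twistedAct]
  simp only [twistedConj, Subgroup.coe_mul, map_mul]
  group

end MaxTorus

end

end RealAlg

/-! Since `ν` is real, the twisted action of `w` is `a ↦ w(a t̃) t̃⁻¹`, and a reflection acts on all
of `T` by `r_i(s) = s · α_i^∨(α_i(s))⁻¹`. Hence `r_i * a = a · α_i^∨(α_i(a) α_i(t̃))`, the inverse
disappearing because `α_i(a) α_i(t̃) = ±1`. Only the `i`-th label can change, and it changes by the
exponent of that sign.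

The sign has two factors. `α_i(t̃) = (-1)^{t_i}` because `t̃²` is central and roots kill the center
(`root_center`). For `a = γ(a_k)`, `α_i(a) = (-1)^{∑ a_k ⟨α_i, α_k^∨⟩}`, so only the parity of the
Cartan integers matters. With an invariant inner product, `⟨α_i, α_k^∨⟩` is odd exactly when `k`
lies in the summation set (`odd_cartan_iff`, `IsBase.odd_pairing_iff_mem`): an even nonzero value
off the diagonal is `±2`, attained on a double edge with `α_k` short.

That `γ` is an isomorphism comes from `X_*/2X_* ≅ T[2]`, `x ↦ x(-1)`. Simple connectedness makes the
simple coroots a basis of `X_*`, and compactness makes conjugation act on `X_*` by `-1`, so all the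
`x(-1)` are real. -/

namespace RealAlg

/-! ### Laurent polynomials on `ℂˣ`, and powers with exponents modulo 2 -/

/-- The Laurent polynomial functions on `ℂˣ`. -/
def laurent : Subalgebra ℂ (ℂˣ → ℂ) where
  carrier := {f | ∃ (N : ℕ) (P : Polynomial ℂ), ∀ z : ℂˣ, (z : ℂ) ^ N * f z = P.eval (z : ℂ)}
  mul_mem' := by
    rintro f g ⟨N, P, hP⟩ ⟨M, Q, hQ⟩
    refine ⟨N + M, P * Q, fun z => ?_⟩
    rw [Polynomial.eval_mul, ← hP, ← hQ, Pi.mul_apply]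
    ring
  add_mem' := by
    rintro f g ⟨N, P, hP⟩ ⟨M, Q, hQ⟩
    refine ⟨N + M, Polynomial.X ^ M * P + Polynomial.X ^ N * Q, fun z => ?_⟩
    simp only [Polynomial.eval_add, Polynomial.eval_mul, Polynomial.eval_pow, Polynomial.eval_X,
      ← hP, ← hQ, Pi.add_apply]
    ring
  algebraMap_mem' := fun c => ⟨0, Polynomial.C c, fun z => by simp⟩

theorem coe_mem_laurent : (fun z : ℂˣ => (z : ℂ)) ∈ laurent := ⟨0, Polynomial.X, fun z => by simp⟩

theorem coe_inv_mem_laurent : (fun z : ℂˣ => ((z⁻¹ : ℂˣ) : ℂ)) ∈ laurent :=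
  ⟨1, 1, fun z => by simp⟩

theorem eval_mem_laurent {σ : Type*} {f : ℂˣ → σ → ℂ} (hf : ∀ s, (fun z => f z s) ∈ laurent)
    (p : MvPolynomial σ ℂ) : (fun z => MvPolynomial.eval (f z) p) ∈ laurent := by
  induction p using MvPolynomial.induction_on with
  | C a =>
    simp only [MvPolynomial.eval_C]
    exact laurent.algebraMap_mem a
  | add p q hp hq =>
    simp only [map_add]
    exact laurent.add_mem hp hq
  | mul_X p s hp =>
    simp only [map_mul, MvPolynomial.eval_X]
    exact laurent.mul_mem hp (hf s)

theorem eval_unitCoords_mem_laurent (p : MvPolynomial (Fin 1 ⊕ Fin 1) ℂ) :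
    (fun z : ℂˣ => MvPolynomial.eval (unitCoords fun _ => z) p) ∈ laurent := by
  refine eval_mem_laurent (fun s => ?_) p
  rcases s with s | s
  · exact coe_mem_laurent
  · exact coe_inv_mem_laurent

/-- A Laurent polynomial without zeros on `ℂˣ` is a monomial. -/
theorem exists_zpow_of_mem_laurent {f : ℂˣ → ℂˣ} (h1 : f 1 = 1)
    (hf : (fun z => (f z : ℂ)) ∈ laurent) : ∃ k : ℤ, ∀ z, f z = z ^ k := by
  obtain ⟨N, P, hP⟩ := hf
  have hroot : ∀ z : ℂ, P.IsRoot z → z = 0 := by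
    intro z hz
    by_contra h0
    have h := hP (Units.mk0 z h0)
    rw [Units.val_mk0, hz.eq_zero] at h
    exact mul_ne_zero (pow_ne_zero _ h0) (Units.ne_zero _) h
  -- With `0` as its only possible root, `P` is `c X^d`; the normalization `f 1 = 1` then gives `c =
  -- 1`.
  have hr : P.roots = Multiset.replicate (Multiset.card P.roots) 0 :=
    Multiset.eq_replicate_card.2 fun z hz => hroot z (Polynomial.isRoot_of_mem_roots hz)
  have hsplit := (IsAlgClosed.splits P).eq_prod_roots
  rw [hr, Multiset.map_replicate, Multiset.prod_replicate, Polynomial.C_0, sub_zero] at hsplit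
  set d := Multiset.card P.roots
  have hP' : ∀ z : ℂˣ, (z : ℂ) ^ N * f z = P.leadingCoeff * (z : ℂ) ^ d := fun z => by
    rw [hP, congrArg (Polynomial.eval (z : ℂ)) hsplit]
    simp
  have hc : P.leadingCoeff = 1 := by simpa [h1] using (hP' 1).symm
  refine ⟨d - N, fun z => ?_⟩
  rw [zpow_sub, eq_mul_inv_iff_mul_eq, zpow_natCast, zpow_natCast, mul_comm]
  apply Units.ext
  push_cast
  rw [hP', hc, one_mul]

theorem zpow_units_injective {a b : ℤ} (h : ∀ z : ℂˣ, z ^ a = z ^ b) : a = b := by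
  have h2 := congrArg (fun u : ℂˣ => ‖(u : ℂ)‖) (h (Units.mk0 2 two_ne_zero))
  simp only [Units.val_zpow_eq_zpow_val, Units.val_mk0, norm_zpow] at h2
  exact zpow_right_injective₀ (a := ‖(2 : ℂ)‖) (by simp) (by simp) h2

theorem eq_zero_of_zpow_bounded {k : ℤ} {C : ℝ} (h : ∀ x : ℝ, 0 < x → x ^ k ≤ C) : k = 0 := by
  have key : ∀ j : ℕ, (∀ x : ℝ, 0 < x → x ^ j ≤ C) → j = 0 := by
    intro j hj
    by_contra h0
    have hx : (0 : ℝ) < |C| + 1 := by positivity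
    have h1 := hj _ hx
    have h2 : |C| + 1 ≤ (|C| + 1) ^ j := le_self_pow₀ (by linarith [abs_nonneg C]) h0
    linarith [le_abs_self C]
  rcases k.eq_nat_or_neg with ⟨j, rfl | rfl⟩
  · exact_mod_cast key j fun x hx => by simpa using h x hx
  · simpa using key j fun x hx => by simpa using h x⁻¹ (inv_pos.2 hx)

theorem exists_unitCoords_zpow (k : ℤ) : ∃ p : MvPolynomial (Fin 1 ⊕ Fin 1) ℂ,
    ∀ z : ℂˣ, ((z ^ k : ℂˣ) : ℂ) = MvPolynomial.eval (unitCoords fun _ => z) p := by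
  rcases k.eq_nat_or_neg with ⟨j, rfl | rfl⟩
  · exact ⟨MvPolynomial.X (Sum.inl 0) ^ j, fun z => by simp [unitCoords]⟩
  · exact ⟨MvPolynomial.X (Sum.inr 0) ^ j, fun z => by simp [unitCoords]⟩

theorem pow_val_add {M : Type*} [Monoid M] {u : M} (hu : u ^ 2 = 1) (a b : ZMod 2) :
    u ^ (a + b).val = u ^ a.val * u ^ b.val := by
  rw [ZMod.val_add, ← pow_add]
  exact (pow_eq_pow_mod _ hu).symm

theorem pow_val_sum {M ι : Type*} [CommMonoid M] {u : M} (hu : u ^ 2 = 1) (s : Finset ι)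
    (a : ι → ZMod 2) : u ^ (∑ i ∈ s, a i).val = ∏ i ∈ s, u ^ (a i).val := by
  classical
  induction s using Finset.induction_on with
  | empty => simp
  | insert i s hi ih => rw [Finset.sum_insert hi, Finset.prod_insert hi, pow_val_add hu, ih]

/-! ### Characters, cocharacters and 2-torsion of a torus -/

namespace MaxTorus
variable {m : ℕ} {G : RealGroup m} (T : MaxTorus G)

theorem coords_cochar_mem_laurent (x : T.cochars) (s) :
    (fun z : ℂˣ => coords (x.1 z : GL (Fin m) ℂ) s) ∈ laurent := by
  rcases s with ⟨i, j⟩ | ⟨i, j⟩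
  · obtain ⟨p, hp⟩ := x.2 i j
    simpa [coords, hp] using eval_unitCoords_mem_laurent p
  · obtain ⟨p, hp⟩ := (x⁻¹).2 i j
    have h : ∀ z : ℂˣ, ((x.1 z : GL (Fin m) ℂ)⁻¹).val i j =
        MvPolynomial.eval (unitCoords fun _ => z) p := fun z => by rw [← hp]; rfl
    simp only [coords, Sum.elim_inr, h]
    exact eval_unitCoords_mem_laurent p

/-- `χ ∘ x` is a Laurent polynomial without zeros, hence a monomial; so the default value `0` in
`pairing` is never taken. -/
theorem pairing_spec (χ : T.chars) (x : T.cochars) (z : ℂˣ) :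
    χ.1 (x.1 z) = z ^ T.pairing χ x := by
  have h : ∃ k : ℤ, ∀ z : ℂˣ, χ.1 (x.1 z) = z ^ k := by
    obtain ⟨p, hp⟩ := χ.2
    refine exists_zpow_of_mem_laurent (f := fun z => χ.1 (x.1 z)) (by simp) ?_
    simp only [hp]
    exact eval_mem_laurent (T.coords_cochar_mem_laurent x) p
  rw [pairing, dif_pos h]
  exact h.choose_spec z

theorem pairing_eq {χ : T.chars} {x : T.cochars} {k : ℤ} (h : ∀ z, χ.1 (x.1 z) = z ^ k) :
    T.pairing χ x = k :=
  zpow_units_injective fun z => by rw [← pairing_spec, h]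

theorem pairing_mul (χ ψ : T.chars) (x : T.cochars) :
    T.pairing (χ * ψ) x = T.pairing χ x + T.pairing ψ x :=
  T.pairing_eq fun z => by
    rw [zpow_add, ← pairing_spec, ← pairing_spec]
    rfl

theorem cochar_neg_one_sq (x : T.cochars) : x.1 (-1) ^ 2 = 1 := by
  rw [← map_pow]
  simp

/-- An algebraic isomorphism of `T` with `(ℂˣ)^r` identifies the cocharacters of `T` with `ℤ^r`. -/
structure Coordinates where
  rank : ℕ
  equiv : (Fin rank → ℂˣ) ≃* T.pts
  regular : ∀ i, ∃ p : MvPolynomial ((Fin m × Fin m) ⊕ (Fin m × Fin m)) ℂ,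
    ∀ s : T.pts, ((equiv.symm s i : ℂˣ) : ℂ) = MvPolynomial.eval (coords (s : GL (Fin m) ℂ)) p
  exponents : ∀ x : T.cochars, ∃ k : Fin rank → ℤ, ∀ z, x.1 z = equiv fun i => z ^ k i
  cochar : ∀ k : Fin rank → ℤ, ∃ x : T.cochars, ∀ z, x.1 z = equiv fun i => z ^ k i

theorem nonempty_coordinates : Nonempty T.Coordinates := by
  obtain ⟨r, e, he, he'⟩ := T.isTorus
  refine ⟨⟨r, e, he', fun x => ?_, fun k => ?_⟩⟩
  · have h : ∀ i, ∃ k : ℤ, ∀ z, e.symm (x.1 z) i = z ^ k := fun i => by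
      obtain ⟨p, hp⟩ := he' i
      refine exists_zpow_of_mem_laurent (f := fun z => e.symm (x.1 z) i) (by simp) ?_
      simp only [hp]
      exact eval_mem_laurent (T.coords_cochar_mem_laurent x) p
    choose k hk using h
    refine ⟨k, fun z => ?_⟩
    rw [← e.symm_apply_eq]
    exact funext fun i => hk i z
  · choose q hq using exists_unitCoords_zpow
    refine ⟨⟨{ toFun := fun z => e fun i => z ^ k i
               map_one' := by
                simp only [one_zpow]
                exact map_one e
               map_mul' := fun z w => by
                rw [← map_mul]
                congr 1
                funext i
                exact mul_zpow _ _ _ }, fun i j => ?_⟩, fun z => rfl⟩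
    obtain ⟨p, hp⟩ := he i j
    refine ⟨MvPolynomial.bind₁ (Sum.elim (fun i => q (k i)) fun i => q (-k i)) p, fun z => ?_⟩
    change (e fun i => z ^ k i : GL (Fin m) ℂ).val i j = _
    rw [hp, ← MvPolynomial.coe_aeval_eq_eval, ← MvPolynomial.coe_aeval_eq_eval]
    simp only [RingHom.coe_coe]
    rw [MvPolynomial.aeval_bind₁]
    congr 2
    funext s
    rcases s with s | s
    · exact hq (k s) z
    · exact (congrArg Units.val (zpow_neg z (k s)).symm).trans (hq (-k s) z)

/-- A homomorphism on `T` is determined by its values on the images of the cocharacters. -/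
theorem hom_ext {M : Type*} [CommMonoid M] {f g : T.pts →* M}
    (h : ∀ (x : T.cochars) z, f (x.1 z) = g (x.1 z)) : f = g := by
  obtain ⟨c⟩ := T.nonempty_coordinates
  have key : f.comp c.equiv.toMonoidHom = g.comp c.equiv.toMonoidHom := by
    refine MonoidHom.functions_ext' _ _ _ fun i => MonoidHom.ext fun z => ?_
    -- The inclusion of the `i`-th factor `ℂˣ` is itself a cocharacter, and these factors generate
    -- the torus.
    obtain ⟨x, hx⟩ := c.cochar (Pi.single i 1)
    have : (fun j => z ^ (Pi.single i (1 : ℤ) : Fin c.rank → ℤ) j) =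
        (Pi.mulSingle i z : Fin c.rank → ℂˣ) := by
      funext j
      rcases eq_or_ne j i with rfl | hj
      · simp
      · simp [hj]
    have h' := h x z
    rw [hx, this] at h'
    exact h'
  ext1 t
  simpa using DFunLike.congr_fun key (c.equiv.symm t)

/-- In coordinates `x(-1) = ((-1)^{k_i})`, so all `k_i` are even. This is the injectivity of
`X_*/2X_* → T[2]`; the surjectivity is `exists_neg_one_eq_of_sq`. -/
theorem exists_sq_eq_of_neg_one {x : T.cochars} (hx : x.1 (-1) = 1) :
    ∃ y : T.cochars, y ^ 2 = x := by
  obtain ⟨c⟩ := T.nonempty_coordinates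
  obtain ⟨k, hk⟩ := c.exponents x
  rw [hk, MulEquiv.map_eq_one_iff] at hx
  have hev : ∀ i, Even (k i) := fun i => by
    by_contra h
    have h1 := congrFun hx i
    rw [(Int.not_even_iff_odd.1 h).neg_one_zpow] at h1
    have h2 := congrArg (Units.val : ℂˣ → ℂ) h1
    norm_num at h2
  choose l hl using hev
  obtain ⟨y, hy⟩ := c.cochar l
  refine ⟨y, Subtype.ext (MonoidHom.ext fun z => ?_)⟩
  change y.1 z ^ 2 = x.1 z
  rw [hy, hk, ← map_pow]
  congr 1
  funext i
  rw [hl, zpow_add, Pi.pow_apply, sq]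

theorem exists_neg_one_eq_of_sq {t : T.pts} (ht : t ^ 2 = 1) : ∃ x : T.cochars, x.1 (-1) = t := by
  obtain ⟨c⟩ := T.nonempty_coordinates
  have h : ∀ i, ∃ k : ℤ, (-1 : ℂˣ) ^ k = c.equiv.symm t i := fun i => by
    have h1 := congrArg c.equiv.symm ht
    rw [map_pow, map_one] at h1
    have h2 := congrArg (Units.val : ℂˣ → ℂ) (congrFun h1 i)
    simp only [Pi.pow_apply, Units.val_pow_eq_pow_val, Pi.one_apply, Units.val_one] at h2
    rcases (mul_self_eq_one_iff.1 ((sq _).symm.trans h2)) with h | h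
    · exact ⟨0, Units.ext (by simp [h])⟩
    · exact ⟨1, Units.ext (by simp [h])⟩
  choose k hk using h
  obtain ⟨x, hx⟩ := c.cochar k
  exact ⟨x, by rw [hx, funext hk, MulEquiv.apply_symm_apply]⟩

/-! ### Compactness and complex conjugation on cocharacters -/

/-- The complex conjugate `z ↦ conj (x (conj z))` of a cocharacter. -/
def conjCochar (x : T.cochars) : T.cochars :=
  ⟨T.conjT.comp (x.1.comp (Units.map (starRingEnd ℂ).toMonoidHom)), fun i j => by
    obtain ⟨p, hp⟩ := x.2 i j
    refine ⟨MvPolynomial.map (starRingEnd ℂ) p, fun z => ?_⟩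
    have h1 : ((T.conjT.comp (x.1.comp (Units.map (starRingEnd ℂ).toMonoidHom)) z : T.pts) :
        GL (Fin m) ℂ).val i j = starRingEnd ℂ
        ((x.1 (Units.map (starRingEnd ℂ).toMonoidHom z) : GL (Fin m) ℂ).val i j) := rfl
    rw [h1, hp, MvPolynomial.eval_map, MvPolynomial.eval, MvPolynomial.coe_eval₂Hom,
      MvPolynomial.hom_eval₂, RingHom.comp_id]
    congr 1
    funext s
    rcases s with s | s
    · simp [unitCoords]
    · simp [unitCoords]⟩

theorem conjCochar_apply (x : T.cochars) (z : ℂˣ) :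
    (T.conjCochar x).1 z = T.conjT (x.1 (Units.map (starRingEnd ℂ).toMonoidHom z)) := rfl

theorem conjT_conjT (t : T.pts) : T.conjT (T.conjT t) = t := Subtype.ext (conj_conj t.1)

theorem bounded_of_isCompactGroup (hG : G.IsCompactGroup)
    (p : MvPolynomial ((Fin m × Fin m) ⊕ (Fin m × Fin m)) ℂ) :
    ∃ C : ℝ, ∀ t : T.pts, T.conjT t = t →
      ‖MvPolynomial.eval (coords (t : GL (Fin m) ℂ)) p‖ ≤ C := by
  have hc : Continuous fun g : GL (Fin m) ℂ => MvPolynomial.eval (coords g) p := by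
    refine (MvPolynomial.continuous_eval p).comp (continuous_pi fun s => ?_)
    rcases s with ⟨i, j⟩ | ⟨i, j⟩
    · exact Units.continuous_val.matrix_elem i j
    · exact Units.continuous_coe_inv.matrix_elem i j
  obtain ⟨C, hC⟩ := IsCompact.exists_bound_of_continuousOn hG hc.continuousOn
  exact ⟨C, fun t ht => hC t.1 ⟨T.le t.2, congrArg Subtype.val ht⟩⟩

/-- When `G` is compact, complex conjugation acts on the cocharacters by inversion. -/
theorem mul_conjCochar (hG : G.IsCompactGroup) (x : T.cochars) : x * T.conjCochar x = 1 := by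
  obtain ⟨c⟩ := T.nonempty_coordinates
  obtain ⟨k, hk⟩ := c.exponents (x * T.conjCochar x)
  have hk0 : ∀ i, k i = 0 := fun i => by
    obtain ⟨p, hp⟩ := c.regular i
    obtain ⟨C, hC⟩ := T.bounded_of_isCompactGroup hG p
    -- For real `u > 0` the point `(x · x̄)(u)` is real, so it lies in the compact group `G(ℝ)`; its
    -- `i`-th coordinate `u ^ k i` stays bounded, forcing `k i = 0`.
    refine eq_zero_of_zpow_bounded (C := C) fun u hu => ?_
    have hu0 : (u : ℂ) ≠ 0 := by exact_mod_cast hu.ne'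
    have hreal : Units.map (starRingEnd ℂ).toMonoidHom (Units.mk0 (u : ℂ) hu0) =
        Units.mk0 (u : ℂ) hu0 := Units.ext (by simp)
    have h := hC ((x * T.conjCochar x).1 (Units.mk0 (u : ℂ) hu0)) (by
      change T.conjT (x.1 _ * (T.conjCochar x).1 _) = x.1 _ * (T.conjCochar x).1 _
      rw [conjCochar_apply, hreal, map_mul, conjT_conjT, mul_comm])
    rw [← hp, hk, MulEquiv.symm_apply_apply] at h
    simpa [abs_of_pos hu] using h
  refine Subtype.ext (MonoidHom.ext fun z => ?_)
  rw [hk]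
  simp only [hk0, zpow_zero]
  exact map_one c.equiv

/-- As `-1` is real, `x · x̄ = 1` says that the conjugate of `x(-1)` is its inverse, which is
`x(-1)` itself. -/
theorem cochar_neg_one_mem_two (hG : G.IsCompactGroup) (x : T.cochars) : x.1 (-1) ∈ T.two := by
  refine ⟨?_, T.cochar_neg_one_sq x⟩
  have h : x.1 (-1) * (T.conjCochar x).1 (-1) = 1 :=
    DFunLike.congr_fun (congrArg Subtype.val (T.mul_conjCochar hG x)) (-1)
  have hreal : Units.map (starRingEnd ℂ).toMonoidHom (-1) = -1 := Units.ext (by simp)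
  rw [conjCochar_apply, hreal] at h
  have h2 : x.1 (-1) * x.1 (-1) = 1 := by rw [← sq, cochar_neg_one_sq]
  exact congrArg Subtype.val (mul_left_cancel (h.trans h2.symm))

/-- Central elements of `G` are killed by every root. -/
theorem root_center {χ : T.chars} (hχ : T.IsRoot χ) {z : T.pts} (hz : z ∈ T.center) :
    χ.1 z = 1 := by
  obtain ⟨-, X, hX, hX0, h⟩ := hχ
  have hcomm : z.1.val * X = X * z.1.val := by
    ext i j
    -- The polynomial is the `(i, j)` entry of `z g - g z`. It vanishes on `G` and is linear in `g`,
    -- so its derivative along `X` is the same entry of `z X - X z`.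
    have hp := hX (∑ k, (MvPolynomial.C (z.1.val i k) * MvPolynomial.X (k, j) -
      MvPolynomial.C (z.1.val k j) * MvPolynomial.X (i, k))) (fun g hg => by
        have hgz := congrArg (fun g : GL (Fin m) ℂ => g.val i j) (hz g hg)
        simp only [Units.val_mul, Matrix.mul_apply] at hgz
        simp only [map_sum, map_sub, map_mul, MvPolynomial.eval_C, MvPolynomial.eval_X,
          Finset.sum_sub_distrib]
        rw [sub_eq_zero]
        refine hgz.symm.trans ?_
        exact Finset.sum_congr rfl fun k _ => mul_comm _ _)
    simp only [map_sum, map_sub, MvPolynomial.pderiv_C_mul, MvPolynomial.pderiv_X] at hp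
    rw [← sub_eq_zero, ← hp]
    simp only [map_mul, MvPolynomial.eval_C, Pi.single_apply, Finset.mul_sum,
      apply_ite (MvPolynomial.eval _), map_one, map_zero]
    rw [Finset.sum_comm]
    simp [mul_sub, Finset.sum_sub_distrib, Matrix.mul_apply, mul_comm]
  have h' := h z
  rw [hcomm, mul_assoc, ← Units.val_mul, mul_inv_cancel, Units.val_one, mul_one] at h'
  have h2 : ((χ.1 z : ℂ) - 1) • X = 0 := by rw [sub_smul, one_smul, ← h', sub_self]
  exact Units.ext (sub_eq_zero.1 ((smul_eq_zero.1 h2).resolve_right hX0))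

end MaxTorus
end RealAlg

/-! ### Reflections, root lengths and the parity of Cartan integers -/

namespace RealAlg

/-- Rank two Cartan integers of independent roots of squared lengths `p` and `q`. -/
theorem odd_cartan_iff {c d : ℤ} {p q : ℝ} (hp : 0 < p) (hq : 0 < q) (h : c * q = d * p)
    (hlt : c ^ 2 * q < 4 * p) : Odd c ↔ c * d ≠ 0 ∧ ¬ (c * d = 2 ∧ q < p) := by
  have hcd : c * d < 4 := by
    have h1 : (c * d : ℝ) * p < 4 * p := by
      calc (c * d : ℝ) * p = c * (d * p) := by ring
        _ = c ^ 2 * q := by rw [← h]; ring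
        _ < 4 * p := hlt
    exact_mod_cast lt_of_mul_lt_mul_right h1 hp.le
  have hnn : 0 ≤ c * d := by
    have h1 : 0 ≤ (c * d : ℝ) * p := by
      have : (c * d : ℝ) * p = c ^ 2 * q := by rw [mul_assoc, ← h]; ring
      rw [this]; positivity
    exact_mod_cast nonneg_of_mul_nonneg_left h1 hp
  have hc0 : c = 0 ↔ d = 0 := by
    constructor
    · rintro rfl
      have : (d : ℝ) * p = 0 := by rw [← h]; simp
      exact_mod_cast (mul_eq_zero.1 this).resolve_right hp.ne'
    · rintro rfl
      have : (c : ℝ) * q = 0 := by rw [h]; simp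
      exact_mod_cast (mul_eq_zero.1 this).resolve_right hq.ne'
  by_cases hz : c = 0
  · simp [hz]
  have hd : d ≠ 0 := fun h0 => hz (hc0.2 h0)
  have hcabs : |c| * |d| < 4 := by rw [← abs_mul, abs_of_nonneg hnn]; exact hcd
  have hdpos : 1 ≤ |d| := Int.one_le_abs hd
  have hcpos : 1 ≤ |c| := Int.one_le_abs hz
  have hc4 : |c| < 4 := by nlinarith
  have hd4 : |d| < 4 := by nlinarith
  rw [abs_lt] at hc4 hd4
  obtain ⟨hc1, hc2⟩ := hc4
  obtain ⟨hd1, hd2⟩ := hd4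
  -- Here `0 < c d < 4`. If `c` is even, then `c = ±2`, `d = ±1`, and `c q = d p` gives `p = 2 q`.
  -- If `c` is odd and `c d = 2`, then `q = 2 p`, so the excluded case does not occur.
  interval_cases c <;> interval_cases d <;>
    first
    | omega
    | exact iff_of_true (by decide) ⟨by norm_num, fun hh => by
        first
        | omega
        | (norm_num at h; linarith [hh.2])⟩
    | exact iff_of_false (by decide) fun hh => hh.2 ⟨by norm_num, by norm_num at h; linarith⟩

namespace MaxTorus
variable {m : ℕ} {G : RealGroup m} (T : MaxTorus G)

/-- A reflection in `W` acts on the whole torus by `t ↦ t x(χ(t))⁻¹`. -/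
theorem IsReflection.weylAct_apply {w : T.Weyl} {χ : T.chars} {x : T.cochars}
    (h : T.IsReflection w χ x) (t : T.pts) : T.weylAct w t = t * (x.1 (χ.1 t))⁻¹ := by
  have key : (T.weylAct w).toMonoidHom = MonoidHom.id T.pts * (x.1.comp χ.1)⁻¹ := by
    refine T.hom_ext fun y z => ?_
    have h' := DFunLike.congr_fun (h y) z
    refine h'.trans ?_
    change y.1 z / x.1 z ^ T.pairing χ y = y.1 z * (x.1 (χ.1 (y.1 z)))⁻¹
    rw [pairing_spec, map_zpow, div_eq_mul_inv]
  exact DFunLike.congr_fun key t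

theorem IsReflection.weylAct_mul_self {w : T.Weyl} {χ : T.chars} {x : T.cochars}
    (h : T.IsReflection w χ x) (h2 : T.pairing χ x = 2) : T.weylAct w * T.weylAct w = 1 := by
  ext1 t
  rw [MulAut.mul_apply, MulAut.one_apply, h.weylAct_apply T t, h.weylAct_apply T, map_mul, map_inv,
    pairing_spec, h2, map_mul, map_inv, map_zpow]
  group

theorem IsReflection.weylChar_eq {w : T.Weyl} {χ : T.chars} {x : T.cochars}
    (h : T.IsReflection w χ x) (h2 : T.pairing χ x = 2) (ψ : T.chars) :
    T.weylChar w ψ = ψ * (χ ^ T.pairing ψ x)⁻¹ := by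
  -- Characters transform through `w⁻¹`, which acts as `w` because a reflection is an involution.
  have hinv : T.weylAct w⁻¹ = T.weylAct w := by
    rw [map_inv, inv_eq_iff_mul_eq_one, h.weylAct_mul_self T h2]
  refine Subtype.ext (MonoidHom.ext fun t => ?_)
  change ψ.1 (T.weylAct w⁻¹ t) = ψ.1 t * (χ.1 t ^ T.pairing ψ x)⁻¹
  rw [hinv, h.weylAct_apply T, map_mul, map_inv, pairing_spec]

/-- The class `1 ⊗ χ` of a character in `ℝ ⊗ X^*`. -/
noncomputable def realChar : Additive T.chars →+ ℝ ⊗[ℤ] Additive T.chars :=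
  ((TensorProduct.mk ℤ ℝ (Additive T.chars)) 1).toAddMonoidHom

/-- Pairing with a cocharacter extends linearly to `ℝ ⊗ X^*`, so `χ` pairs to zero with every
cocharacter, and these detect characters. Positivity of the inner product thus applies to nontrivial
characters. -/
theorem realChar_eq_zero {χ : T.chars} (h : T.realChar (Additive.ofMul χ) = 0) : χ = 1 := by
  have hp : ∀ x, T.pairing χ x = 0 := fun x => by
    let f : Additive T.chars →+ ℤ :=
      { toFun := fun ψ => T.pairing ψ.toMul x
        map_zero' := T.pairing_eq fun z => by simp
        map_add' := fun ψ φ => T.pairing_mul ψ.toMul φ.toMul x }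
    have hf : TensorProduct.rid ℤ ℝ (f.toIntLinearMap.baseChange ℝ
        (T.realChar (Additive.ofMul χ))) = T.pairing χ x • (1 : ℝ) := rfl
    rw [h, map_zero, map_zero] at hf
    simpa using hf.symm
  refine Subtype.ext (T.hom_ext fun x z => ?_)
  rw [pairing_spec, hp, zpow_zero]
  rfl

section Inner
variable {T} {B : LinearMap.BilinForm ℝ (ℝ ⊗[ℤ] Additive T.chars)}

/-- Expand `B(wψ, wχ) = B(ψ, χ)` using, additively, `wχ = -χ` and `wψ = ψ - ⟨ψ, x⟩χ`. -/
theorem IsInvariantInner.two_mul_eq (hB : T.IsInvariantInner B) {w : T.Weyl} {χ : T.chars} {x : T.cochars}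
    (h : T.IsReflection w χ x) (h2 : T.pairing χ x = 2) (ψ : T.chars) :
    2 * B (T.realChar (Additive.ofMul ψ)) (T.realChar (Additive.ofMul χ)) =
      T.pairing ψ x * T.sqLength B χ := by
  have key : B (T.realChar (Additive.ofMul (T.weylChar w ψ)))
      (T.realChar (Additive.ofMul (T.weylChar w χ))) =
      B (T.realChar (Additive.ofMul ψ)) (T.realChar (Additive.ofMul χ)) := hB.invariant w ψ χ
  rw [h.weylChar_eq T h2, h.weylChar_eq T h2, h2] at key
  simp only [ofMul_mul, ofMul_inv, ofMul_zpow, map_add, map_neg, map_zsmul, LinearMap.add_apply,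
    LinearMap.neg_apply, LinearMap.smul_apply, zsmul_eq_mul] at key
  change _ = _ * B (T.realChar (Additive.ofMul χ)) (T.realChar (Additive.ofMul χ))
  push_cast at key
  linarith

theorem IsInvariantInner.sqLength_pos (hB : T.IsInvariantInner B) {χ : T.chars} (h : χ ≠ 1) : 0 < T.sqLength B χ :=
  hB.pos _ fun h0 => h (T.realChar_eq_zero h0)

theorem IsInvariantInner.odd_pairing_iff (hB : T.IsInvariantInner B) {v w : T.Weyl}
    {χ ψ : T.chars} {x y : T.cochars} (hχ : T.IsReflection v χ x) (hψ : T.IsReflection w ψ y)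
    (hx : T.pairing χ x = 2) (hy : T.pairing ψ y = 2)
    (hind : LinearIndependent ℤ ![Additive.ofMul χ, Additive.ofMul ψ]) :
    Odd (T.pairing χ y) ↔ T.pairing χ y * T.pairing ψ x ≠ 0 ∧
      ¬ (T.pairing χ y * T.pairing ψ x = 2 ∧ T.sqLength B ψ < T.sqLength B χ) := by
  have h1 := hB.two_mul_eq hψ hy χ
  have h2 := hB.two_mul_eq hχ hx ψ
  have hne : ∀ a b : ℤ, a • Additive.ofMul χ + b • Additive.ofMul ψ = 0 → a = 0 ∧ b = 0 :=
    LinearIndependent.pair_iff.1 hind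
  have hχ1 : χ ≠ 1 := fun h => by simpa [h] using hne 1 0
  have hψ1 : ψ ≠ 1 := fun h => by simpa [h] using hne 0 1
  have hs := hB.symm (T.realChar (Additive.ofMul ψ)) (T.realChar (Additive.ofMul χ))
  refine odd_cartan_iff (hB.sqLength_pos hχ1) (hB.sqLength_pos hψ1) (by linarith) ?_
  -- Strict Cauchy–Schwarz in integral form: with `c = ⟨χ, y⟩`, the vector `2χ - cψ` is nonzero by
  -- independence and has squared length `4|χ|² - c²|ψ|²`.
  have hv : 0 < T.sqLength B (χ ^ (2 : ℤ) * ψ ^ (-T.pairing χ y)) :=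
    hB.sqLength_pos fun h0 => by
      have := (hne 2 (-T.pairing χ y) (congrArg Additive.ofMul h0)).1
      omega
  have hexp : T.sqLength B (χ ^ (2 : ℤ) * ψ ^ (-T.pairing χ y)) =
      B (T.realChar (Additive.ofMul (χ ^ (2 : ℤ) * ψ ^ (-T.pairing χ y))))
        (T.realChar (Additive.ofMul (χ ^ (2 : ℤ) * ψ ^ (-T.pairing χ y)))) := rfl
  have hpp : B (T.realChar (Additive.ofMul χ)) (T.realChar (Additive.ofMul χ)) =
    T.sqLength B χ := rfl
  have hqq : B (T.realChar (Additive.ofMul ψ)) (T.realChar (Additive.ofMul ψ)) =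
    T.sqLength B ψ := rfl
  rw [hexp] at hv
  simp only [ofMul_mul, ofMul_zpow, map_add, map_zsmul, LinearMap.add_apply,
    LinearMap.smul_apply, zsmul_eq_mul, hpp, hqq, hs] at hv
  push_cast at hv
  nlinarith [congrArg (fun u => (T.pairing χ y : ℝ) * u) h1]

end Inner

end MaxTorus
end RealAlg

/-! ### Labelings and the twisted action -/

namespace RealAlg
namespace MaxTorus
variable {m : ℕ} {G : RealGroup m} {T : MaxTorus G}

section Base
variable {n : ℕ} {α : Fin n → T.chars} {αv : Fin n → T.cochars}

/-- Coroots generate `X_*` by simple connectedness, and each coroot or its inverse is a product of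
simple ones. -/
theorem IsBase.exists_prod_eq (hbase : T.IsBase α αv) (hsc : T.IsSimplyConnected)
    (x : T.cochars) : ∃ c : Fin n → ℤ, ∏ j, αv j ^ c j = x := by
  have hle : Submonoid.closure (Set.range αv) ≤
      (Subgroup.closure (Set.range αv)).toSubmonoid :=
    Submonoid.closure_le.2 Subgroup.subset_closure
  have htop : Subgroup.closure (Set.range αv) = ⊤ := by
    rw [eq_top_iff, ← show Subgroup.closure _ = ⊤ from hsc, Subgroup.closure_le]
    rintro y ⟨β, hy⟩
    rcases hbase.coroot_mem_or_inv_mem β y hy with h | h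
    · exact hle h
    · exact inv_mem_iff.1 (hle h)
  have hx : x ∈ Subgroup.closure (Set.range αv) := htop ▸ Subgroup.mem_top x
  induction hx using Subgroup.closure_induction with
  | mem y hy =>
    obtain ⟨i, rfl⟩ := hy
    refine ⟨Pi.single i 1, ?_⟩
    rw [Finset.prod_eq_single i (fun j _ hj => by simp [hj]) (by simp)]
    simp
  | one => exact ⟨0, by simp⟩
  | mul y z _ _ hy hz =>
    obtain ⟨c, rfl⟩ := hy
    obtain ⟨d, rfl⟩ := hz
    exact ⟨c + d, by simp [zpow_add, Finset.prod_mul_distrib]⟩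
  | inv y _ hy =>
    obtain ⟨c, rfl⟩ := hy
    exact ⟨-c, by simp⟩

theorem coe_prod_zpow_apply (c : Fin n → ℤ) (z : ℂˣ) :
    (∏ j, αv j ^ c j : T.cochars).1 z = ∏ j, (αv j).1 z ^ c j := by
  simp

/-- The labelings of the Dynkin diagram, as elements of the two-torsion of the real torus. -/
def labeling (hG : G.IsCompactGroup) (αv : Fin n → T.cochars) :
    Multiplicative (Fin n → ZMod 2) →* T.two where
  toFun a := ∏ j, (⟨(αv j).1 (-1), T.cochar_neg_one_mem_two hG (αv j)⟩ : T.two) ^ (a.toAdd j).val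
  map_one' := by simp
  map_mul' a b := by
    rw [← Finset.prod_mul_distrib]
    refine Finset.prod_congr rfl fun j _ => ?_
    rw [toAdd_mul, Pi.add_apply, pow_val_add]
    exact Subtype.ext (T.cochar_neg_one_sq (αv j))

theorem coe_labeling (hG : G.IsCompactGroup) (a : Fin n → ZMod 2) :
    (labeling hG αv (Multiplicative.ofAdd a)).1 = ∏ j, ((αv j).1 (-1)) ^ (a j).val := by
  change T.two.subtype (∏ j, _) = _
  rw [map_prod]
  rfl

theorem IsBase.labeling_bijective (hbase : T.IsBase α αv) (hsc : T.IsSimplyConnected)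
    (hG : G.IsCompactGroup) : Function.Bijective (labeling hG αv) := by
  constructor
  · rw [injective_iff_map_eq_one]
    intro a ha
    have h1 := coe_labeling (αv := αv) hG a.toAdd
    have h2 : (∏ j, αv j ^ ((a.toAdd j).val : ℤ) : T.cochars).1 (-1) = 1 := by
      rw [coe_prod_zpow_apply]
      simp only [zpow_natCast]
      rw [← h1, ofAdd_toAdd, ha]
      rfl
    obtain ⟨y, hy⟩ := T.exists_sq_eq_of_neg_one h2
    obtain ⟨d, rfl⟩ := hbase.exists_prod_eq hsc y
    -- Comparing exponents of independent coroots gives `a_j = 2 d_j`; the representative `0` or `1`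
    -- of `a_j` must then be `0`.
    have h3 : ∑ j, (2 * d j - ((a.toAdd j).val : ℤ)) • Additive.ofMul (αv j) = 0 := by
      have h4 : (∏ j, αv j ^ (2 * d j - ((a.toAdd j).val : ℤ))) = 1 := by
        simp only [zpow_sub, Finset.prod_mul_distrib, Finset.prod_inv_distrib, ← hy,
          ← Finset.prod_pow]
        rw [mul_inv_eq_one]
        refine Finset.prod_congr rfl fun j _ => ?_
        rw [mul_comm, zpow_mul]
        rfl
      have h5 := congrArg Additive.ofMul h4
      rw [ofMul_prod] at h5
      exact h5
    have h4 := Fintype.linearIndependent_iff.1 hbase.linearIndependent_coroot _ h3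
    refine funext fun j => ?_
    have h5 := h4 j
    have h6 : (a.toAdd j).val = 0 := by
      have := ZMod.val_lt (a.toAdd j)
      omega
    exact (ZMod.val_eq_zero _).1 h6
  · intro s
    obtain ⟨x, hx⟩ := T.exists_neg_one_eq_of_sq s.2.2
    obtain ⟨c, rfl⟩ := hbase.exists_prod_eq hsc x
    refine ⟨Multiplicative.ofAdd fun j => (c j : ZMod 2), Subtype.ext ?_⟩
    rw [coe_labeling, ← hx, coe_prod_zpow_apply]
    refine Finset.prod_congr rfl fun j _ => ?_
    rw [← zpow_natCast, ZMod.val_intCast]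
    exact (zpow_eq_zpow_emod' _ (T.cochar_neg_one_sq (αv j))).symm

theorem coe_twistedAct_eq {t : T.Tad} (ht : T.IsAdTwo t) {tl : T.pts} (htl : (tl : T.Tad) = t)
    (w : T.Weyl) (a : T.two) :
    (T.twistedAct ht htl w a).1 = T.weylAct w (a.1 * tl) * tl⁻¹ := by
  obtain ⟨k, rfl⟩ := QuotientGroup.mk_surjective w
  exact Subtype.ext ((T.coe_twistedAct ht htl k a).trans (T.twisted_eq tl k a.1))

/-- A root takes the values `±1` on lifts of two-torsion elements of the adjoint torus. -/
theorem IsRoot.exists_sign {χ : T.chars} (hχ : T.IsRoot χ) {tl : T.pts}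
    (h : (tl : T.Tad) ^ 2 = 1) : ∃ s : ZMod 2, χ.1 tl = (-1) ^ s.val := by
  have hz : tl ^ 2 ∈ T.center := by
    rw [← QuotientGroup.eq_one_iff]
    exact h
  have h1 := T.root_center hχ hz
  rw [map_pow] at h1
  have h2 := congrArg (Units.val : ℂˣ → ℂ) h1
  rw [Units.val_pow_eq_pow_val, Units.val_one] at h2
  rcases mul_self_eq_one_iff.1 ((sq _).symm.trans h2) with h | h
  · exact ⟨0, Units.ext (by simp [h])⟩
  · exact ⟨1, Units.ext (by simp [h, ZMod.val_one])⟩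

/-- Translates the edge-and-length condition into parity. On the diagonal both sides fail, since
`⟨α_i, α_i^∨⟩ = 2` and `edges` is `0`. -/
theorem IsBase.odd_pairing_iff_mem (hbase : T.IsBase α αv)
    {r : Fin n → T.Weyl} (hr : ∀ i, T.IsReflection (r i) (α i) (αv i))
    {B : LinearMap.BilinForm ℝ (ℝ ⊗[ℤ] Additive T.chars)} (hB : T.IsInvariantInner B)
    (i k : Fin n) : Odd (T.pairing (α i) (αv k)) ↔ k ∈ T.summationSet α αv B i := by
  rw [summationSet, Finset.mem_filter, edges]
  rcases eq_or_ne i k with rfl | hik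
  · simp [(hbase.coroot i).2.1]
  · rw [if_neg hik, hB.odd_pairing_iff (hr i) (hr k) (hbase.coroot i).2.1 (hbase.coroot k).2.1]
    · simp
    · have h := hbase.linearIndependent_root.comp ![i, k] (by
        intro a b
        fin_cases a <;> fin_cases b <;> simp [hik, hik.symm])
      convert h using 1
      funext a
      fin_cases a <;> rfl

/-- The factor at `k` is `(-1)^{⟨α_i, α_k^∨⟩ a_k}`, which is trivial unless the pairing is odd. -/
theorem IsBase.root_labeling (hbase : T.IsBase α αv) (hG : G.IsCompactGroup)
    {r : Fin n → T.Weyl} (hr : ∀ i, T.IsReflection (r i) (α i) (αv i))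
    {B : LinearMap.BilinForm ℝ (ℝ ⊗[ℤ] Additive T.chars)} (hB : T.IsInvariantInner B)
    (i : Fin n) (a : Fin n → ZMod 2) :
    (α i).1 (labeling hG αv (Multiplicative.ofAdd a)).1 =
      (-1) ^ (∑ k ∈ T.summationSet α αv B i, a k).val := by
  classical
  rw [coe_labeling, map_prod, pow_val_sum (by simp),
    ← Finset.prod_filter_mul_prod_filter_not Finset.univ (· ∈ T.summationSet α αv B i),
    Finset.filter_mem_eq_inter, Finset.univ_inter]
  have h2 : ∀ k ∈ Finset.univ.filter (· ∉ T.summationSet α αv B i),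
      (α i).1 ((αv k).1 (-1) ^ (a k).val) = 1 := fun k hk => by
    have hk' := (hbase.odd_pairing_iff_mem hr hB i k).not.2 (Finset.mem_filter.1 hk).2
    rw [map_pow, pairing_spec, (Int.not_odd_iff_even.1 hk').neg_one_zpow, one_pow]
  rw [Finset.prod_eq_one h2, mul_one]
  refine Finset.prod_congr rfl fun k hk => ?_
  rw [map_pow, pairing_spec, ((hbase.odd_pairing_iff_mem hr hB i k).2 hk).neg_one_zpow]

theorem labeling_single (hG : G.IsCompactGroup) (i : Fin n) (s : ZMod 2) :
    (labeling hG αv (Multiplicative.ofAdd (Pi.single i s))).1 = (αv i).1 ((-1) ^ s.val) := by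
  rw [coe_labeling, Finset.prod_eq_single i (fun j _ hj => by simp [hj]) (by simp),
    Pi.single_eq_same, map_pow]

end Base
end MaxTorus
end RealAlg

/-! ### The main theorem -/

theorem lemma3p2 {m : ℕ} (G : RealAlg.RealGroup m) (hsimple : G.IsSimple)
    (hcompact : G.IsCompactGroup) (T : RealAlg.MaxTorus G) (hsc : T.IsSimplyConnected)
    {n : ℕ} (α : Fin n → T.chars) (αv : Fin n → T.cochars) (hbase : T.IsBase α αv)
    -- the simple reflections in the Weyl group
    (r : Fin n → T.Weyl) (hr : ∀ i, T.IsReflection (r i) (α i) (αv i))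
    -- an invariant inner product, by which lengths of roots are compared
    (B : LinearMap.BilinForm ℝ (TensorProduct ℤ ℝ (Additive T.chars)))
    (hB : T.IsInvariantInner B)
    -- an element of order dividing two in the adjoint torus, and a lift of it
    (t : T.Tad) (ht : T.IsAdTwo t) (tl : T.pts) (htl : (tl : T.Tad) = t) :
    -- the colouring
    ∃ tt : Fin n → ZMod 2, (∀ i, (α i).1 tl = (-1) ^ (tt i).val) ∧
    -- the canonical isomorphism of labelings with the 2-torsion of the real torus
    ∃ γ : Multiplicative (Fin n → ZMod 2) ≃* T.two,
      (∀ a : Fin n → ZMod 2,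
        (γ (Multiplicative.ofAdd a)).1 = ∏ j, ((αv j).1 (-1)) ^ (a j).val) ∧
      -- the moves
      ∀ (i : Fin n) (a a' : Fin n → ZMod 2),
        T.twistedAct ht htl (r i) (γ (Multiplicative.ofAdd a)) = γ (Multiplicative.ofAdd a') →
          (∀ j, j ≠ i → a' j = a j) ∧
          a' i = a i + tt i + ∑ k ∈ T.summationSet α αv B i, a k := by
  subst htl
  choose tt htt using fun i => (hbase.coroot i).1.exists_sign ht.2
  refine ⟨tt, htt, MulEquiv.ofBijective _ (hbase.labeling_bijective hsc hcompact),
    RealAlg.MaxTorus.coe_labeling hcompact, fun i a a' h => ?_⟩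
  set s : ZMod 2 := tt i + ∑ k ∈ T.summationSet α αv B i, a k with hs
  -- By injectivity of `γ` it suffices to compare in `T`, where `r_i * γ(a) = γ(a) · α_i^∨((-1)^s)`
  -- and the last factor is `γ` of the label `s` at `i`.
  have key : a' = a + Pi.single i s := by
    apply Multiplicative.ofAdd.injective
    apply (hbase.labeling_bijective hsc hcompact).1
    refine h.symm.trans (Subtype.ext ?_)
    have hsq : (-1 : ℂˣ) ^ 2 = 1 := by simp
    have hinv : ((αv i).1 ((-1) ^ s.val))⁻¹ = (αv i).1 ((-1) ^ s.val) := by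
      rw [← map_inv, ← inv_pow, inv_neg, inv_one]
    rw [RealAlg.MaxTorus.coe_twistedAct_eq, (hr i).weylAct_apply, MulEquiv.ofBijective_apply,
      map_mul, hbase.root_labeling hcompact hr hB, htt, ← RealAlg.pow_val_add hsq,
      add_comm _ (tt i), ← hs, hinv, ofAdd_add, map_mul, Subgroup.coe_mul, RealAlg.MaxTorus.labeling_single,
      mul_right_comm, mul_inv_cancel_right]
  constructor
  · intro j hj
    simp [key, hj]
  · simp [key, hs, add_assoc]
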